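/- **Lemma (Finding robust bases).** Let $\mathcal O$ be a finite alphabet and let $\Pr[\cdot]$ be a distribution over observation sequences of length $T$ over $\mathcal O$, given by its conditionals $\Pr[o\mid h]$ ($o\in\mathcal O$, $h\in\mathcal O^{<T}$, including a fixed choice for histories $h$ of probability zero), so that $\Pr[of\mid h]=\Pr[o\mid h]\Pr[f\mid ho]$ and $\Pr[\varphi\mid h]=1$ for the empty string $\varphi$. Write $H_t=\mathcal O^t$, $F_t=\mathcal O^{T-t}$, $[T]=\{1,\dots,T\}$, and let $\Pr[F\mid B]$ be the matrix with entries $\Pr[f\mid b]$, $f \in F$, $b\in B$. For a square matrix $M$ let $\sigma_+(M)$ be the smallest magnitude of a nonzero eigenvalue of $M$. * $\Pr[\cdot]$ has *rank $r$* if $\operatorname{rank}\Pr[\mathcal O^{\le T-t}\mid\mathcal O^t]\le r$ for every $t\in[T]$. * Finite families $B_t$ ($t\in[T]$) of histories in $H_t$, repetitions allowed, are *bases* if for every $t\in[T]$ and every $x\in H_t$ with $\Pr[x]>0$ there is a vector $\beta(x)$ with $\Pr[F_t\mid x]=\Pr[F_t\mid B_t]\,\beta(x)$ and $\|\beta(x)\|_2\le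 1$. Put $d_t(f)=\frac1{|B_t|}\sum_{b\in B_t}\Pr[f\mid b]$ and let $D_t$ be the diagonal matrix with entries $d_t(f)$, $f\in F_t$; in $D_t^{-1}$ the entries with $d_t(f)=0$ are set to $0$. * $\Pr[\cdot]$ has *fidelity $\Delta^*$* if there are bases $\{B_t\}_{t\in[T]}$ such that for every $t\in[T]$ we have $|B_t|\le 1/\Delta^*$ and $\sigma_+\big(S_t^{1/2}\Pr[F_t\mid H_t]^\top D_t^{-1}\Pr[F_t\mid H_t]S_t^{1/2}\big)\ge\Delta^*$, where $S_t$ is the diagonal matrix with entries $\Pr[h]$, $h\in H_t$. * Bases $\{B_t\}_{t\in[T]}$ are *$\Delta$-robust* if $\sigma_+\big(\Pr[F_t\mid B_t]^\top D_t^{-1}\Pr[F_t\mid B_t]\big)\ge\Delta$ for every $t\in[T]$. There are universal constants $C,c>0$ such that the following holds. Let $\Pr[\cdot]$ have rank $r$ and fidelity $\Delta^*>0$, let $0<\delta<1$, let $n$ be any integer with $n\ge C\,(\Delta^*)^{-8}\log(rT/\delta)$, and put $\Delta=c\,(\Delta^*)^{-11/2}\log(rT/\delta)$. For each $t\in[T]$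 let $B_t$ be a random sample of $n$ independent observation sequences of length $t$ drawn from $\Pr[\cdot]$ (no independence between different $t$ is required). Then, with probability at least $1-\delta$, $\{B_t\}_{t\in[T]}$ are $\Delta$-robust bases for $\Pr[\cdot]$. -/

import Mathlib

open scoped Matrix

noncomputable section

/-- A distribution over observation sequences of length `T` over the alphabet `O`, defined through
its conditionals: `next h o` is the probability `Pr[o | h]` that the observation following the
history `h` is `o`. A conditional distribution is committed to for every history of length `< T`,
also for the histories of probability zero. (Values at longer histories are never used.) -/
structure SeqDist (O : Type*) [Fintype O] (T : ℕ) where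
  next : List O → O → ℝ
  next_nonneg : ∀ h : List O, h.length < T → ∀ o : O, 0 ≤ next h o
  next_sum : ∀ h : List O, h.length < T → ∑ o : O, next h o = 1

namespace SeqDist

variable {O : Type*} [Fintype O] {T : ℕ}

/-- `Pr[f | h]` for a history `h` and a future `f` (meaningful if `len h + len f ≤ T`), by the
chain rule `Pr[o f | h] = Pr[o | h] Pr[f | h o]`. -/
def condProb (P : SeqDist O T) : List O → List O → ℝ
  | _, [] => 1
  | h, o :: f => P.next h o * P.condProb (h ++ [o]) f

/-- `Pr[h]`, for a history `h` of length `t`. -/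
def prob (P : SeqDist O T) {t : ℕ} (h : Fin t → O) : ℝ :=
  P.condProb [] (List.ofFn h)

/-- The matrix `Pr[O^{≤ T-t} | O^t]`: rows are the futures of length at most `T - t`, columns the
histories of length `t`. -/
def fullCondMatrix (P : SeqDist O T) (t : ℕ) :
    Matrix (Σ k : Fin (T - t + 1), (Fin k → O)) (Fin t → O) ℝ :=
  Matrix.of fun f h => P.condProb (List.ofFn h) (List.ofFn f.2)

/-- `P` has rank (at most) `r`. -/
def HasRank (P : SeqDist O T) (r : ℕ) : Prop :=
  ∀ t ∈ Finset.Icc 1 T, (P.fullCondMatrix t).rank ≤ r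

/-- The matrix `Pr[F_t | B]`, with `F_t = O^{T-t}`, for a family `B` of histories of length `t`;
its columns are indexed like the family, so repeated histories give repeated columns. -/
def condMatrix (P : SeqDist O T) {t : ℕ} {ι : Type*} (B : ι → Fin t → O) :
    Matrix (Fin (T - t) → O) ι ℝ :=
  Matrix.of fun f b => P.condProb (List.ofFn (B b)) (List.ofFn f)

/-- `d(f) = (1 / |B|) ∑_{b ∈ B} Pr[f | b]`. -/
def mixture (P : SeqDist O T) {t m : ℕ} (B : Fin m → Fin t → O) (f : Fin (T - t) → O) : ℝ :=
  (1 / (m : ℝ)) * ∑ b, P.condMatrix B f b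

variable [DecidableEq O]

/-- `D⁻¹`, the inverse of the diagonal matrix with entries `d(f)`. Futures with `d(f) = 0` are
left out (their entry is `0⁻¹ = 0`), so that `Aᵀ * D⁻¹ * A` is the sum over the futures with
`d(f) ≠ 0`. -/
def mixtureInv (P : SeqDist O T) {t m : ℕ} (B : Fin m → Fin t → O) :
    Matrix (Fin (T - t) → O) (Fin (T - t) → O) ℝ :=
  Matrix.diagonal fun f => (P.mixture B f)⁻¹

/-- The preconditioned matrix `Pr[F_t | B]ᵀ D⁻¹ Pr[F_t | B]`. -/
def precondMatrix (P : SeqDist O T) {t m : ℕ} (B : Fin m → Fin t → O) :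
    Matrix (Fin m) (Fin m) ℝ :=
  (P.condMatrix B)ᵀ * P.mixtureInv B * P.condMatrix B

/-- The diagonal matrix `S_t^{1/2}`, where `S_t` has the entries `Pr[h]`. -/
def sqrtProbMatrix (P : SeqDist O T) (t : ℕ) : Matrix (Fin t → O) (Fin t → O) ℝ :=
  Matrix.diagonal fun h => √(P.prob h)

/-- The matrix `S_t^{1/2} Pr[F_t | H_t]ᵀ D⁻¹ Pr[F_t | H_t] S_t^{1/2}`, with `H_t = O^t` and `D`
given by the family `B`. -/
def fidelityMatrix (P : SeqDist O T) {t m : ℕ} (B : Fin m → Fin t → O) :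
    Matrix (Fin t → O) (Fin t → O) ℝ :=
  P.sqrtProbMatrix t * (P.condMatrix (id : (Fin t → O) → Fin t → O))ᵀ * P.mixtureInv B *
    P.condMatrix (id : (Fin t → O) → Fin t → O) * P.sqrtProbMatrix t

end SeqDist

/-- `σ₊(M)`: the smallest magnitude of a nonzero eigenvalue of `M`. -/
def sigmaPlus {ι : Type*} [Fintype ι] (M : Matrix ι ι ℝ) : ℝ :=
  sInf {a : ℝ | ∃ μ : ℝ, Module.End.HasEigenvalue M.mulVecLin μ ∧ μ ≠ 0 ∧ a = |μ|}

namespace SeqDist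

variable {O : Type*} [Fintype O] {T : ℕ}

/-- The families `B_t`, `t ∈ [T]`, of histories of length `t` (repetitions allowed) are bases for
`P`: every history `x` of length `t` that occurs with positive probability has coefficients
`β(x)` with `Pr[F_t | x] = Pr[F_t | B_t] β(x)`, normalised so that `‖β(x)‖₂ ≤ 1`. -/
def IsBases (P : SeqDist O T) {m : ℕ → ℕ} (B : ∀ t, Fin (m t) → Fin t → O) : Prop :=
  ∀ t ∈ Finset.Icc 1 T, ∀ x : Fin t → O, 0 < P.prob x →
    ∃ β : EuclideanSpace ℝ (Fin (m t)),
      (∀ f : Fin (T - t) → O,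
        P.condProb (List.ofFn x) (List.ofFn f) = (P.condMatrix (B t) *ᵥ β.ofLp) f) ∧
      ‖β‖ ≤ 1

variable [DecidableEq O]

/-- `P` has fidelity `Δ'`. -/
def HasFidelity (P : SeqDist O T) (Δ' : ℝ) : Prop :=
  ∃ (m : ℕ → ℕ) (B : ∀ t, Fin (m t) → Fin t → O), P.IsBases B ∧
    ∀ t ∈ Finset.Icc 1 T, (m t : ℝ) ≤ 1 / Δ' ∧ Δ' ≤ sigmaPlus (P.fidelityMatrix (B t))

/-- The families `B_t`, `t ∈ [T]`, are `Δ`-robust bases for `P`. -/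
def IsRobustBases (P : SeqDist O T) (Δ : ℝ) {m : ℕ → ℕ} (B : ∀ t, Fin (m t) → Fin t → O) :
    Prop :=
  P.IsBases B ∧ ∀ t ∈ Finset.Icc 1 T, Δ ≤ sigmaPlus (P.precondMatrix (B t))

end SeqDist

/-- `X 0, …, X (n-1)` is a random sample of size `n` of observation sequences of length `t` from
`P`: independent random variables with `Pr(X i = h) = Pr[h]`. -/
structure IsRandomSample {O : Type*} [Fintype O] [MeasurableSpace O] {T : ℕ} (P : SeqDist O T)
    {Ω : Type*} [MeasurableSpace Ω] (μ : MeasureTheory.Measure Ω) {t n : ℕ}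
    (X : Fin n → Ω → Fin t → O) : Prop where
  measurable : ∀ i, Measurable (X i)
  indep : ProbabilityTheory.iIndepFun X μ
  law : ∀ i (h : Fin t → O), μ {ω | X i ω = h} = ENNReal.ofReal (P.prob h)

end

/-! Fix `t` and the bases `B` that witness fidelity, let `q` be their mixture, and put `v_h(f) =
Pr[f | h] / √q(f)`. On the span `W` of the `v_h` with `Pr[h] > 0`, fidelity says that `E_h ⟨v_h, w⟩²
≥ Δ' ‖w‖²` (`sigmaPlus_fidelityMatrix_le`).

The same lower bound, halved, holds for a random sample. Since `v_h = ∑ β(h)_b v_b` with `|β(h)_b| ≤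
1`, the form depends on the sample only through the `m²` moments of `β_b β_b'`, where `m ≤ 1/Δ'`,
and Hoeffding's inequality controls each of them. As `∑_b ⟨v_b, w⟩² ≤ m ‖w‖²`, the errors add up to
at most half of the main term, so `∑_i ⟨v_{X i}, w⟩² ≥ γ ‖w‖²` on `W` with `γ = n Δ' / 2`
(`gram_ge_of_moments_close`).

Both conclusions follow from this Gram bound (`coeff_and_sigmaPlus_of_gram_ge`). Any `x` in `W` is a
combination of the sampled columns with squared coefficient norm at most `‖x‖² / γ`, and `‖v_h‖² ≤ K
= 1/Δ'` because `Pr[f | h] ≤ m q(f)`. An eigenvector of the preconditioned matrix with nonzero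
eigenvalue is the shortest coefficient vector of its image; comparing the sample mixture with `K q`
bounds the eigenvalue below by `γ / K = n Δ'² / 2`. A union bound over moments and lengths finishes
the proof. -/

/-! ### Linear algebra: nonzero eigenvalues, Gram forms and small coefficients. -/

theorem sigmaPlus_le {ι : Type*} [Fintype ι] {M : Matrix ι ι ℝ} {μ : ℝ} {z : ι → ℝ}
    (hz : z ≠ 0) (hμ : μ ≠ 0) (h : M *ᵥ z = μ • z) : sigmaPlus M ≤ |μ| := by
  refine csInf_le ⟨0, ?_⟩ ⟨μ, ?_, hμ, rfl⟩
  · rintro a ⟨ν, -, -, rfl⟩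
    exact abs_nonneg ν
  · exact Module.End.hasEigenvalue_of_hasEigenvector
      (Module.End.hasEigenvector_iff.2 ⟨Module.End.mem_eigenspace_iff.2 h, hz⟩)

/-- A positive semidefinite matrix satisfies `σ₊(M) M ≤ M²`. -/
theorem sigmaPlus_mul_dotProduct_le {ι : Type*} [Fintype ι] [DecidableEq ι] {M : Matrix ι ι ℝ}
    (hM : M.PosSemidef) (z : ι → ℝ) :
    sigmaPlus M * (z ⬝ᵥ M *ᵥ z) ≤ (M *ᵥ z) ⬝ᵥ (M *ᵥ z) := by
  have hH := hM.isHermitian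
  set b := hH.eigenvectorBasis with hb
  have hMb : ∀ i, M *ᵥ (b i).ofLp = hH.eigenvalues i • (b i).ofLp := fun i =>
    hH.mulVec_eigenvectorBasis i
  have parseval : ∀ x y : ι → ℝ,
      x ⬝ᵥ y = ∑ i, (x ⬝ᵥ (b i).ofLp) * ((b i).ofLp ⬝ᵥ y) := by
    intro x y
    have h := b.sum_inner_mul_inner (WithLp.toLp 2 x) (WithLp.toLp 2 y)
    simp only [EuclideanSpace.inner_eq_star_dotProduct, star_trivial] at h
    rw [dotProduct_comm x y, ← h]
    exact Finset.sum_congr rfl fun i _ => by rw [dotProduct_comm x, dotProduct_comm _ y]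
  have hcoef : ∀ i, (b i).ofLp ⬝ᵥ (M *ᵥ z) = hH.eigenvalues i * ((b i).ofLp ⬝ᵥ z) := by
    intro i
    have hT : Mᵀ = M := by simpa [Matrix.conjTranspose_eq_transpose_of_trivial] using hH.eq
    rw [Matrix.dotProduct_mulVec, ← Matrix.mulVec_transpose, hT, hMb, smul_dotProduct, smul_eq_mul]
  rw [parseval z, parseval (M *ᵥ z), Finset.mul_sum]
  refine Finset.sum_le_sum fun i _ => ?_
  rw [dotProduct_comm z, dotProduct_comm (M *ᵥ z), hcoef]
  have hnn : 0 ≤ hH.eigenvalues i := hM.eigenvalues_nonneg i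
  -- In eigencoordinates a zero eigenvalue contributes nothing to either side, and every other
  -- eigenvalue is at least `sigmaPlus M`.
  rcases eq_or_lt_of_le hnn with h0 | hpos
  · simp [← h0]
  · have hne : (b i).ofLp ≠ 0 := fun h0 => b.orthonormal.ne_zero i (by ext j; simp [h0])
    have hle := sigmaPlus_le hne hpos.ne' (hMb i)
    rw [abs_of_pos hpos] at hle
    nlinarith [mul_nonneg hnn (sq_nonneg ((b i).ofLp ⬝ᵥ z)),
      mul_le_mul_of_nonneg_right hle (mul_nonneg hnn (sq_nonneg ((b i).ofLp ⬝ᵥ z)))]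

theorem dotProduct_sq_le {ι : Type*} [Fintype ι] (x y : ι → ℝ) :
    (x ⬝ᵥ y) ^ 2 ≤ (x ⬝ᵥ x) * (y ⬝ᵥ y) := by
  have := Finset.sum_mul_sq_le_sq_mul_sq Finset.univ x y
  simpa [dotProduct, ← sq] using this

/-- Vectors whose Gram form is bounded below on a subspace represent each vector of the subspace
with small coefficients. -/
theorem exists_coeff_of_gram_ge {ι F : Type*} [Fintype ι] [Fintype F] {v : ι → F → ℝ}
    {W : Submodule ℝ (F → ℝ)} (hv : ∀ i, v i ∈ W) {γ : ℝ} (hγ : 0 < γ)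
    (gram : ∀ w ∈ W, γ * (w ⬝ᵥ w) ≤ ∑ i, (v i ⬝ᵥ w) ^ 2) {x : F → ℝ} (hx : x ∈ W) :
    ∃ β : ι → ℝ, ∑ i, β i • v i = x ∧ γ * ∑ i, β i ^ 2 ≤ x ⬝ᵥ x := by
  -- The frame operator on `W`. The Gram bound makes it injective, hence surjective by finite
  -- dimension; a preimage `w` of `x` gives the coefficients `⟨v i, w⟩`, whose squares sum to `⟨w,
  -- x⟩`.
  let G : W →ₗ[ℝ] W :=
    { toFun := fun w => ⟨∑ i, (v i ⬝ᵥ (w : F → ℝ)) • v i,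
        W.sum_mem fun i _ => W.smul_mem _ (hv i)⟩
      map_add' := fun w w' => by
        ext1
        simp [dotProduct_add, add_smul, Finset.sum_add_distrib]
      map_smul' := fun a w => by
        ext1
        simp [dotProduct_smul, smul_smul, Finset.smul_sum] }
  have hG : ∀ w : W, (w : F → ℝ) ⬝ᵥ (G w : F → ℝ) = ∑ i, (v i ⬝ᵥ (w : F → ℝ)) ^ 2 := by
    intro w
    change (w : F → ℝ) ⬝ᵥ (∑ i, (v i ⬝ᵥ (w : F → ℝ)) • v i) = _
    rw [dotProduct_sum]
    exact Finset.sum_congr rfl fun i _ => by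
      rw [dotProduct_smul, dotProduct_comm (w : F → ℝ), smul_eq_mul, sq]
  have hinj : Function.Injective G := by
    rw [← LinearMap.ker_eq_bot, LinearMap.ker_eq_bot']
    intro w hw
    have h1 := gram w w.2
    rw [← hG, hw] at h1
    have h2 : (w : F → ℝ) ⬝ᵥ (w : F → ℝ) ≤ 0 := by
      simp only [ZeroMemClass.coe_zero, dotProduct_zero] at h1
      nlinarith
    have h3 : (w : F → ℝ) = 0 :=
      dotProduct_self_eq_zero.1 (le_antisymm h2 (Finset.sum_nonneg fun i _ => mul_self_nonneg _))
    exact Subtype.ext h3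
  obtain ⟨w, hw⟩ := LinearMap.surjective_of_injective hinj ⟨x, hx⟩
  refine ⟨fun i => v i ⬝ᵥ (w : F → ℝ), congrArg Subtype.val hw, ?_⟩
  have h1 := gram w w.2
  have h2 := hG w
  rw [hw] at h2
  have h3 := dotProduct_sq_le (w : F → ℝ) x
  rw [h2] at h3
  set s := ∑ i, (v i ⬝ᵥ (w : F → ℝ)) ^ 2
  have hs : 0 ≤ s := Finset.sum_nonneg fun i _ => sq_nonneg _
  have hxx : 0 ≤ x ⬝ᵥ x := Finset.sum_nonneg fun i _ => mul_self_nonneg _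
  rcases hs.eq_or_lt with h0 | hpos
  · simpa [← h0] using hxx
  · refine le_of_mul_le_mul_right ?_ hpos
    nlinarith [mul_le_mul_of_nonneg_right h1 hxx]

/-- The preconditioned matrix of a column-stochastic matrix `A` with row means `d`: a lower bound
for its nonzero eigenvalues from a comparison of `d` with other weights `q`. -/
theorem le_sigmaPlus_precond {F : Type*} [Fintype F] [DecidableEq F] {n : ℕ} (hn : 0 < n)
    {A : Matrix F (Fin n) ℝ} (hA : ∀ f i, 0 ≤ A f i) (hsum : ∀ i, ∑ f, A f i = 1)
    {d : F → ℝ} (hd : ∀ f, d f = (1 / (n : ℝ)) * ∑ i, A f i)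
    {q : F → ℝ} {K γ : ℝ} (hK : 0 < K) (hγ : 0 < γ)
    (hAq : ∀ f i, A f i ≤ K * q f)
    (hrep : ∀ z : Fin n → ℝ, ∃ β : Fin n → ℝ, A *ᵥ β = A *ᵥ z ∧
      γ * ∑ i, β i ^ 2 ≤ ∑ f, (A *ᵥ z) f ^ 2 * (q f)⁻¹) :
    γ / K ≤ sigmaPlus (Aᵀ * Matrix.diagonal (fun f => (d f)⁻¹) * A) := by
  have hn' : (0 : ℝ) < n := by exact_mod_cast hn
  have hd0 : ∀ f, 0 ≤ d f := fun f => by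
    rw [hd]
    exact mul_nonneg (by positivity) (Finset.sum_nonneg fun i _ => hA f i)
  have hdA : ∀ f, d f = 0 → ∀ i, A f i = 0 := by
    intro f hf i
    rw [hd, mul_eq_zero] at hf
    rcases hf with hf | hf
    · simp [hn.ne'] at hf
    · exact (Finset.sum_eq_zero_iff_of_nonneg fun i _ => hA f i).1 hf i (Finset.mem_univ i)
  have hdq : ∀ f, d f ≤ K * q f := by
    intro f
    rw [hd]
    have : ∑ i, A f i ≤ n * (K * q f) := by
      calc ∑ i, A f i ≤ ∑ _i : Fin n, K * q f := Finset.sum_le_sum fun i _ => hAq f i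
        _ = n * (K * q f) := by simp
    calc 1 / (n : ℝ) * ∑ i, A f i ≤ 1 / (n : ℝ) * (n * (K * q f)) := by gcongr
      _ = K * q f := by field_simp
  set M := Aᵀ * Matrix.diagonal (fun f => (d f)⁻¹) * A with hMdef
  have hform : ∀ y z : Fin n → ℝ,
      y ⬝ᵥ (M *ᵥ z) = ∑ f, (A *ᵥ y) f * ((d f)⁻¹ * (A *ᵥ z) f) := by
    intro y z
    rw [hMdef, ← Matrix.mulVec_mulVec, ← Matrix.mulVec_mulVec, Matrix.dotProduct_mulVec,
      Matrix.vecMul_transpose]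
    simp [dotProduct, Matrix.mulVec_diagonal]
  -- A nonzero eigenvalue must exist, since `sInf ∅ = 0` would defeat the lower bound. The all-ones
  -- vector provides `n`.
  have hones : M *ᵥ (fun _ => 1) = (n : ℝ) • fun _ => 1 := by
    ext i
    have h := hform (Pi.single i 1) (fun _ => 1)
    rw [single_one_dotProduct] at h
    rw [h, Pi.smul_apply, smul_eq_mul, mul_one]
    have : ∀ f, (A *ᵥ Pi.single i 1) f * ((d f)⁻¹ * (A *ᵥ fun _ => 1) f) = n * A f i := by
      intro f
      have hs : (A *ᵥ fun _ => (1 : ℝ)) f = n * d f := by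
        rw [hd]
        simp only [Matrix.mulVec, dotProduct, mul_one]
        field_simp
      rw [hs]
      simp only [Matrix.mulVec_single_one, Matrix.col_apply]
      by_cases h0 : d f = 0
      · simp [hdA f h0]
      · field_simp
    rw [Finset.sum_congr rfl fun f _ => this f, ← Finset.mul_sum, hsum, mul_one]
  refine le_csInf ?_ ?_
  · have h1 : (fun _ : Fin n => (1 : ℝ)) ≠ 0 := fun h => one_ne_zero (congrFun h ⟨0, hn⟩)
    exact ⟨_, n, Module.End.hasEigenvalue_of_hasEigenvector
      (Module.End.hasEigenvector_iff.2 ⟨Module.End.mem_eigenspace_iff.2 hones, h1⟩), hn'.ne', rfl⟩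
  · rintro a ⟨μ, hμ, hμ0, rfl⟩
    obtain ⟨z, hz⟩ := hμ.exists_hasEigenvector
    have hMz : M *ᵥ z = μ • z := hz.apply_eq_smul
    have hz0 : z ≠ 0 := hz.2
    obtain ⟨β, hβ, hβle⟩ := hrep z
    have hzz : 0 < z ⬝ᵥ z :=
      lt_of_le_of_ne (Finset.sum_nonneg fun i _ => mul_self_nonneg _)
        fun h => hz0 (dotProduct_self_eq_zero.1 h.symm)
    -- `β - z` lies in the kernel of `A`, and `z` is orthogonal to it because `μ ≠ 0`; hence `z` is
    -- no longer than `β`.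
    have hβz : β ⬝ᵥ z = z ⬝ᵥ z := by
      have h1 : β ⬝ᵥ (M *ᵥ z) = z ⬝ᵥ (M *ᵥ z) := by rw [hform, hform, hβ]
      rw [hMz, dotProduct_smul, dotProduct_smul] at h1
      exact mul_left_cancel₀ hμ0 h1
    have hzβ : z ⬝ᵥ z ≤ ∑ i, β i ^ 2 := by
      have h1 := dotProduct_sq_le β z
      rw [hβz, sq] at h1
      have h2 := le_of_mul_le_mul_right h1 hzz
      simpa [dotProduct, ← sq] using h2
    -- `d ≤ K q` turns the `q`-weighted norm of `A *ᵥ z` into the `d`-weighted one, which is the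
    -- eigenvalue form.
    have hcmp : ∑ f, (A *ᵥ z) f ^ 2 * (q f)⁻¹ ≤ K * (μ * (z ⬝ᵥ z)) := by
      have h1 : μ * (z ⬝ᵥ z) = z ⬝ᵥ (M *ᵥ z) := by rw [hMz, dotProduct_smul, smul_eq_mul]
      rw [h1, hform, Finset.mul_sum]
      refine Finset.sum_le_sum fun f _ => ?_
      rcases (hd0 f).eq_or_lt with h0 | hpos
      · have : (A *ᵥ z) f = 0 := by
          simp [Matrix.mulVec, dotProduct, hdA f h0.symm]
        simp [this]
      · have hKq : 0 < K * q f := hpos.trans_le (hdq f)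
        have h2 : (K * q f)⁻¹ ≤ (d f)⁻¹ := inv_anti₀ hpos (hdq f)
        have h3 : (q f)⁻¹ ≤ K * (d f)⁻¹ := by
          calc (q f)⁻¹ = K * (K * q f)⁻¹ := by rw [mul_inv]; field_simp
            _ ≤ K * (d f)⁻¹ := by gcongr
        nlinarith [mul_le_mul_of_nonneg_left h3 (sq_nonneg ((A *ᵥ z) f))]
    have hfin : γ * (z ⬝ᵥ z) ≤ K * μ * (z ⬝ᵥ z) := by
      nlinarith [mul_le_mul_of_nonneg_left hzβ hγ.le]
    have := le_of_mul_le_mul_right hfin hzz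
    rw [div_le_iff₀ hK, mul_comm]
    exact this.trans (mul_le_mul_of_nonneg_left (le_abs_self μ) hK.le)

/-! ### Scaled columns of the conditional matrix and what fidelity says about them. -/

namespace SeqDist

variable {O : Type*} [Fintype O] {T : ℕ}

theorem condProb_nonneg (P : SeqDist O T) (f h : List O) (hT : h.length + f.length ≤ T) :
    0 ≤ P.condProb h f := by
  induction f generalizing h with
  | nil => simp [condProb]
  | cons o f ih =>
    simp only [List.length_cons] at hT
    exact mul_nonneg (P.next_nonneg h (by omega) o) (ih _ (by simp; omega))

theorem sum_condProb (P : SeqDist O T) (k : ℕ) (h : List O) (hT : h.length + k ≤ T) :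
    ∑ f : Fin k → O, P.condProb h (List.ofFn f) = 1 := by
  induction k generalizing h with
  | zero => simp [condProb]
  | succ k ih =>
    rw [← (Fin.consEquiv fun _ => O).sum_comp, Fintype.sum_prod_type,
      ← P.next_sum h (by omega)]
    refine Finset.sum_congr rfl fun o _ => ?_
    simp only [Fin.consEquiv_apply, List.ofFn_succ, Fin.cons_zero, Fin.cons_succ, condProb]
    rw [← Finset.mul_sum, ih _ (by simp; omega), mul_one]

theorem prob_nonneg (P : SeqDist O T) {t : ℕ} (ht : t ≤ T) (h : Fin t → O) : 0 ≤ P.prob h :=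
  P.condProb_nonneg _ _ (by simpa using ht)

theorem sum_prob (P : SeqDist O T) {t : ℕ} (ht : t ≤ T) : ∑ h : Fin t → O, P.prob h = 1 :=
  P.sum_condProb t [] (by simpa using ht)

theorem exists_prob_pos (P : SeqDist O T) {t : ℕ} (ht : t ≤ T) : ∃ h : Fin t → O, 0 < P.prob h := by
  obtain ⟨h, -, hh⟩ := Finset.exists_lt_of_sum_lt (s := Finset.univ) (f := fun _ => (0 : ℝ))
    (g := fun h : Fin t → O => P.prob h) (by simp [P.sum_prob ht])
  exact ⟨h, hh⟩

theorem condMatrix_nonneg (P : SeqDist O T) {t : ℕ} (ht : t ≤ T) {ι : Type*} (B : ι → Fin t → O)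
    (f : Fin (T - t) → O) (b : ι) : 0 ≤ P.condMatrix B f b :=
  P.condProb_nonneg _ _ (by simp; omega)

theorem sum_condMatrix (P : SeqDist O T) {t : ℕ} (ht : t ≤ T) {ι : Type*} (B : ι → Fin t → O)
    (b : ι) : ∑ f, P.condMatrix B f b = 1 :=
  P.sum_condProb _ _ (by simp; omega)

/-- The column `Pr[F_t | h]`, with the entry at `f` divided by `√(q f)`. -/
noncomputable def scaledColumn (P : SeqDist O T) {t : ℕ} (q : (Fin (T - t) → O) → ℝ) (h : Fin t → O)
    (f : Fin (T - t) → O) : ℝ :=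
  √(q f)⁻¹ * P.condProb (List.ofFn h) (List.ofFn f)

/-- The range of the scaled columns weighted by the probabilities of the histories. -/
noncomputable def weightedRange (P : SeqDist O T) (t : ℕ) (q : (Fin (T - t) → O) → ℝ) :
    Submodule ℝ ((Fin (T - t) → O) → ℝ) :=
  LinearMap.range (Matrix.of fun f (h : Fin t → O) =>
    P.scaledColumn q h f * √(P.prob h)).mulVecLin

theorem mixture_nonneg (P : SeqDist O T) {t m : ℕ} (ht : t ≤ T) (B : Fin m → Fin t → O)
    (f : Fin (T - t) → O) : 0 ≤ P.mixture B f :=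
  mul_nonneg (by positivity) (Finset.sum_nonneg fun b _ => P.condMatrix_nonneg ht B f b)

/-- `∑_b ⟨v_b, w⟩² ≤ m ‖w‖²` for the columns `v_b` scaled by their own mixture. -/
theorem sum_scaledColumn_mixture_sq_le (P : SeqDist O T) {t m : ℕ} (ht : t ≤ T)
    (B : Fin m → Fin t → O) (w : (Fin (T - t) → O) → ℝ) :
    ∑ b, (P.scaledColumn (P.mixture B) (B b) ⬝ᵥ w) ^ 2 ≤ m * (w ⬝ᵥ w) := by
  -- Cauchy–Schwarz with the probability weights `Pr[f | b]`. Summing over `b` then turns these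
  -- weights into `m` times the mixture, which cancels its inverse.
  have h1 : ∀ b, (P.scaledColumn (P.mixture B) (B b) ⬝ᵥ w) ^ 2 ≤
      ∑ f, P.condMatrix B f b * ((P.mixture B f)⁻¹ * w f ^ 2) := by
    intro b
    have := Finset.sum_sq_le_sum_mul_sum_of_sq_le_mul Finset.univ
      (r := fun f => P.scaledColumn (P.mixture B) (B b) f * w f)
      (f := fun f => P.condMatrix B f b)
      (g := fun f => P.condMatrix B f b * ((P.mixture B f)⁻¹ * w f ^ 2))
      (fun f _ => P.condMatrix_nonneg ht B f b)
      (fun f _ => mul_nonneg (P.condMatrix_nonneg ht B f b)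
        (mul_nonneg (inv_nonneg.2 (P.mixture_nonneg ht B f)) (sq_nonneg _)))
      (fun f _ => le_of_eq <| by
        conv_rhs => rw [← Real.mul_self_sqrt (inv_nonneg.2 (P.mixture_nonneg ht B f))]
        simp only [scaledColumn, condMatrix, Matrix.of_apply]
        ring)
    rwa [P.sum_condMatrix ht, one_mul] at this
  refine (Finset.sum_le_sum fun b _ => h1 b).trans ?_
  rw [Finset.sum_comm, dotProduct, Finset.mul_sum]
  refine Finset.sum_le_sum fun f _ => ?_
  rw [← Finset.sum_mul]
  rcases Nat.eq_zero_or_pos m with rfl | hm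
  · simp
  have hm' : (0 : ℝ) < m := by exact_mod_cast hm
  have h2 : ∑ b, P.condMatrix B f b = m * P.mixture B f := by
    rw [mixture]; field_simp
  rw [h2]
  rcases (P.mixture_nonneg ht B f).eq_or_lt with h0 | hpos
  · rw [← h0]
    simp only [mul_zero, zero_mul]
    exact mul_nonneg hm'.le (mul_self_nonneg _)
  · apply le_of_eq
    field_simp

variable [DecidableEq O]

/-- A family of histories whose scaled columns have a large Gram form provides coefficients of
norm at most one, and a well-conditioned preconditioned matrix. -/
theorem coeff_and_sigmaPlus_of_gram_ge (P : SeqDist O T) {t n : ℕ} (ht : t ≤ T) (hn : 0 < n)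
    {B : Fin n → Fin t → O} (hB : ∀ i, 0 < P.prob (B i)) {q : (Fin (T - t) → O) → ℝ}
    (hq : ∀ f, 0 ≤ q f) {K γ : ℝ} (hK : 0 < K) (hKγ : K ≤ γ)
    (hPq : ∀ h : Fin t → O, 0 < P.prob h → ∀ f : Fin (T - t) → O,
      P.condProb (List.ofFn h) (List.ofFn f) ≤ K * q f)
    {W : Submodule ℝ ((Fin (T - t) → O) → ℝ)}
    (hW : ∀ h : Fin t → O, 0 < P.prob h → P.scaledColumn q h ∈ W)
    (gram : ∀ w ∈ W, γ * (w ⬝ᵥ w) ≤ ∑ i, (P.scaledColumn q (B i) ⬝ᵥ w) ^ 2) :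
    (∀ x : Fin t → O, 0 < P.prob x → ∃ β : EuclideanSpace ℝ (Fin n),
      (∀ f : Fin (T - t) → O,
        P.condProb (List.ofFn x) (List.ofFn f) = (P.condMatrix B *ᵥ β.ofLp) f) ∧ ‖β‖ ≤ 1) ∧
    γ / K ≤ sigmaPlus (P.precondMatrix B) := by
  have hγ : 0 < γ := hK.trans_le hKγ
  have hnn : ∀ h f, 0 ≤ P.condProb (List.ofFn (h : Fin t → O)) (List.ofFn f) := fun h f =>
    P.condMatrix_nonneg ht id f h
  -- Scaling by `√(q f)⁻¹` erases the futures with `q f = 0`. Domination by `K * q f` makes the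
  -- original entries vanish there too, so nothing is lost.
  have hzero : ∀ h : Fin t → O, 0 < P.prob h → ∀ f : Fin (T - t) → O, q f = 0 →
      P.condProb (List.ofFn h) (List.ofFn f) = 0 := fun h hh f hf =>
    le_antisymm (by simpa [hf] using hPq h hh f) (hnn h f)
  have hsum : ∀ (z : Fin n → ℝ) f,
      (∑ i, z i • P.scaledColumn q (B i)) f = √(q f)⁻¹ * (P.condMatrix B *ᵥ z) f := by
    intro z f
    simp only [Finset.sum_apply, Pi.smul_apply, smul_eq_mul, scaledColumn, Matrix.mulVec,
      dotProduct, condMatrix, Matrix.of_apply, Finset.mul_sum]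
    exact Finset.sum_congr rfl fun i _ => by ring
  have hBzero : ∀ (z : Fin n → ℝ) f, q f = 0 → (P.condMatrix B *ᵥ z) f = 0 := by
    intro z f hf
    simp only [Matrix.mulVec, dotProduct, condMatrix, Matrix.of_apply]
    exact Finset.sum_eq_zero fun i _ => by rw [hzero _ (hB i) f hf, zero_mul]
  have hcancel : ∀ f (a b : ℝ), (q f = 0 → a = 0 ∧ b = 0) → √(q f)⁻¹ * a = √(q f)⁻¹ * b →
      a = b := by
    intro f a b h0 hab
    rcases (hq f).eq_or_lt with hf | hf
    · rw [(h0 hf.symm).1, (h0 hf.symm).2]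
    · exact mul_left_cancel₀ (Real.sqrt_pos.2 (inv_pos.2 hf)).ne' hab
  have hsq : ∀ f, √(q f)⁻¹ * √(q f)⁻¹ = (q f)⁻¹ := fun f =>
    Real.mul_self_sqrt (inv_nonneg.2 (hq f))
  refine ⟨fun x hx => ?_, ?_⟩
  · obtain ⟨β, hβ, hle⟩ := exists_coeff_of_gram_ge (fun i => hW _ (hB i)) hγ gram (hW x hx)
    refine ⟨WithLp.toLp 2 β, fun f => ?_, ?_⟩
    · refine hcancel f _ _ (fun hf => ⟨hzero x hx f hf, hBzero β f hf⟩) ?_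
      rw [← hsum β f, hβ]
      rfl
    -- `Pr[f | x]² / q(f) ≤ K Pr[f | x]`, and the right side sums to `K`; then `K ≤ γ` makes the
    -- coefficient norm at most one.
    · have hxK : P.scaledColumn q x ⬝ᵥ P.scaledColumn q x ≤ K := by
        calc P.scaledColumn q x ⬝ᵥ P.scaledColumn q x
            ≤ ∑ f : Fin (T - t) → O, K * P.condProb (List.ofFn x) (List.ofFn f) := by
              refine Finset.sum_le_sum fun f _ => ?_
              have h1 : P.scaledColumn q x f * P.scaledColumn q x f
                  = P.condProb (List.ofFn x) (List.ofFn f) ^ 2 * (q f)⁻¹ := by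
                rw [← hsq f, scaledColumn]; ring
              rw [h1]
              rcases (hq f).eq_or_lt with hf | hf
              · simp [hzero x hx f hf.symm]
              · rw [← div_eq_mul_inv, div_le_iff₀ hf]
                nlinarith [mul_le_mul_of_nonneg_left (hPq x hx f) (hnn x f)]
          _ = K := by rw [← Finset.mul_sum, P.sum_condProb _ _ (by simp; omega), mul_one]
      rw [EuclideanSpace.norm_eq, Real.sqrt_le_one]
      simp only [Real.norm_eq_abs, sq_abs]
      refine le_of_mul_le_mul_left ?_ hγ
      linarith
  · refine le_sigmaPlus_precond hn (fun f i => P.condMatrix_nonneg ht B f i)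
      (fun i => P.sum_condMatrix ht B i) (fun f => rfl) hK hγ (fun f i => hPq _ (hB i) f) ?_
    intro z
    obtain ⟨β, hβ, hle⟩ := exists_coeff_of_gram_ge (fun i => hW _ (hB i)) hγ gram
      (W.sum_mem fun i _ => W.smul_mem (z i) (hW _ (hB i)))
    refine ⟨β, funext fun f => hcancel f _ _ (fun hf => ⟨hBzero β f hf, hBzero z f hf⟩) ?_, ?_⟩
    · rw [← hsum, ← hsum, hβ]
    · refine hle.trans (le_of_eq (Finset.sum_congr rfl fun f _ => ?_))
      rw [hsum]
      linear_combination ((P.condMatrix B *ᵥ z) f ^ 2) * hsq f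

theorem scaledColumn_mem_weightedRange (P : SeqDist O T) {t : ℕ} (q : (Fin (T - t) → O) → ℝ)
    (h : Fin t → O) (hh : 0 < P.prob h) : P.scaledColumn q h ∈ P.weightedRange t q := by
  refine ⟨Pi.single h (√(P.prob h))⁻¹, ?_⟩
  ext f
  have : √(P.prob h) ≠ 0 := (Real.sqrt_pos.2 hh).ne'
  simp [this]

/-- The fidelity matrix is `NᵀN`, where the columns of `N` are the scaled columns times `√Pr[h]`.
With `w = N z`, the inequality `σ₊(M) M ≤ M²` at `z` reads `σ₊ ‖w‖² ≤ ‖Nᵀ w‖²`. -/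
theorem sigmaPlus_fidelityMatrix_le (P : SeqDist O T) {t m : ℕ} (ht : t ≤ T)
    (B : Fin m → Fin t → O) {w : (Fin (T - t) → O) → ℝ}
    (hw : w ∈ P.weightedRange t (P.mixture B)) :
    sigmaPlus (P.fidelityMatrix B) * (w ⬝ᵥ w) ≤
      ∑ h, P.prob h * (P.scaledColumn (P.mixture B) h ⬝ᵥ w) ^ 2 := by
  obtain ⟨z, rfl⟩ := hw
  set N : Matrix (Fin (T - t) → O) (Fin t → O) ℝ := Matrix.of fun f (h : Fin t → O) =>
    P.scaledColumn (P.mixture B) h f * √(P.prob h) with hN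
  have hM : P.fidelityMatrix B = Nᵀ * N := by
    have hN' : N = Matrix.diagonal (fun f => √(P.mixture B f)⁻¹) *
        P.condMatrix (id : (Fin t → O) → Fin t → O) * P.sqrtProbMatrix t := by
      ext f h
      simp [hN, sqrtProbMatrix, scaledColumn, condMatrix, Matrix.mul_diagonal,
        Matrix.diagonal_mul]
    have hD : P.mixtureInv B = Matrix.diagonal (fun f => √(P.mixture B f)⁻¹) *
        Matrix.diagonal (fun f => √(P.mixture B f)⁻¹) := by
      rw [Matrix.diagonal_mul_diagonal, mixtureInv]
      congr 1
      ext f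
      rw [Real.mul_self_sqrt (inv_nonneg.2 (P.mixture_nonneg ht B f))]
    rw [hN', fidelityMatrix, hD]
    simp only [Matrix.transpose_mul, Matrix.diagonal_transpose, sqrtProbMatrix, Matrix.mul_assoc]
  have hpsd : (Nᵀ * N).PosSemidef := by
    simpa [Matrix.conjTranspose_eq_transpose_of_trivial] using
      Matrix.posSemidef_conjTranspose_mul_self N
  have h := sigmaPlus_mul_dotProduct_le hpsd z
  rw [hM]
  simp only [Matrix.mulVecLin_apply]
  have h1 : z ⬝ᵥ (Nᵀ * N) *ᵥ z = N *ᵥ z ⬝ᵥ N *ᵥ z := by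
    rw [← Matrix.mulVec_mulVec, Matrix.dotProduct_mulVec, Matrix.vecMul_transpose]
  rw [h1] at h
  refine h.trans (le_of_eq (Finset.sum_congr rfl fun h' _ => ?_))
  have h2 : ((Nᵀ * N) *ᵥ z) h' = √(P.prob h') * (P.scaledColumn (P.mixture B) h' ⬝ᵥ N *ᵥ z) := by
    rw [← Matrix.mulVec_mulVec]
    simp only [Matrix.mulVec, dotProduct, Matrix.transpose_apply, Finset.mul_sum, hN,
      Matrix.of_apply]
    refine Finset.sum_congr rfl fun f _ => Finset.sum_congr rfl fun _ _ => by ring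
  rw [h2, mul_mul_mul_comm, Real.mul_self_sqrt (P.prob_nonneg ht h'), sq]

end SeqDist

/-! ### From moments of the coefficients to the empirical Gram form. -/

open MeasureTheory ProbabilityTheory

theorem sum_sum_mul_mul_ge {κ : Type*} [Fintype κ] {X Y : κ → κ → ℝ} {η : ℝ} (hη : 0 ≤ η)
    (h : ∀ b b', |X b b' - Y b b'| ≤ η) (u : κ → ℝ) :
    ∑ b, ∑ b', Y b b' * (u b * u b') - η * (Fintype.card κ * ∑ b, u b ^ 2) ≤
      ∑ b, ∑ b', X b b' * (u b * u b') := by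
  have h1 : (∑ b, |u b|) ^ 2 ≤ Fintype.card κ * ∑ b, u b ^ 2 := by
    simpa using sq_sum_le_card_mul_sum_sq (s := Finset.univ) (f := fun b => |u b|)
  have h2 : ∑ b, ∑ b', Y b b' * (u b * u b') - ∑ b, ∑ b', X b b' * (u b * u b') ≤
      ∑ b, ∑ b', η * (|u b| * |u b'|) := by
    simp only [← Finset.sum_sub_distrib]
    refine Finset.sum_le_sum fun b _ => Finset.sum_le_sum fun b' _ => ?_
    calc Y b b' * (u b * u b') - X b b' * (u b * u b')
        ≤ |Y b b' * (u b * u b') - X b b' * (u b * u b')| := le_abs_self _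
      _ = |X b b' - Y b b'| * (|u b| * |u b'|) := by
          rw [← sub_mul, abs_mul, abs_mul, abs_sub_comm]
      _ ≤ η * (|u b| * |u b'|) := by
          gcongr
          exact h b b'
  have h3 : ∑ b, ∑ b', η * (|u b| * |u b'|) = η * (∑ b, |u b|) ^ 2 := by
    rw [sq, Finset.sum_mul_sum, Finset.mul_sum]
    exact Finset.sum_congr rfl fun b _ => by rw [Finset.mul_sum]
  rw [h3] at h2
  linarith [mul_le_mul_of_nonneg_left h1 hη]

namespace SeqDist

variable {O : Type*} [Fintype O] {T : ℕ}

theorem scaledColumn_dotProduct (P : SeqDist O T) {t m : ℕ} (q : (Fin (T - t) → O) → ℝ)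
    {B : Fin m → Fin t → O} {x : Fin t → O} {β : Fin m → ℝ}
    (hβ : ∀ f : Fin (T - t) → O,
      P.condProb (List.ofFn x) (List.ofFn f) = (P.condMatrix B *ᵥ β) f)
    (w : (Fin (T - t) → O) → ℝ) :
    P.scaledColumn q x ⬝ᵥ w = ∑ b, β b * (P.scaledColumn q (B b) ⬝ᵥ w) := by
  have : P.scaledColumn q x = ∑ b, β b • P.scaledColumn q (B b) := by
    ext f
    simp only [scaledColumn, hβ, Matrix.mulVec, dotProduct, condMatrix, Matrix.of_apply,
      Finset.sum_apply, Pi.smul_apply, smul_eq_mul, Finset.mul_sum]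
    exact Finset.sum_congr rfl fun b _ => by ring
  rw [this, sum_dotProduct]
  simp

/-- If the empirical second moments of the coefficients are close to their expectations, then the
empirical Gram form of the scaled columns is close to its expectation. -/
theorem gram_ge_of_moments_close (P : SeqDist O T) {t m n : ℕ} (ht : t ≤ T)
    {B : Fin m → Fin t → O} {β : (Fin t → O) → Fin m → ℝ}
    (hβ : ∀ x : Fin t → O, 0 < P.prob x → ∀ f : Fin (T - t) → O,
      P.condProb (List.ofFn x) (List.ofFn f) = (P.condMatrix B *ᵥ β x) f)
    {X : Fin n → Fin t → O} (hX : ∀ i, 0 < P.prob (X i)) {η : ℝ} (hη : 0 ≤ η)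
    (hdev : ∀ b b', |∑ i, β (X i) b * β (X i) b' -
      n * ∑ h, P.prob h * (β h b * β h b')| ≤ η) (w : (Fin (T - t) → O) → ℝ) :
    n * ∑ h, P.prob h * (P.scaledColumn (P.mixture B) h ⬝ᵥ w) ^ 2 - η * (m * (m * (w ⬝ᵥ w))) ≤
      ∑ i, (P.scaledColumn (P.mixture B) (X i) ⬝ᵥ w) ^ 2 := by
  set u : Fin m → ℝ := fun b => P.scaledColumn (P.mixture B) (B b) ⬝ᵥ w with hu
  have hsq : ∀ x : Fin t → O, 0 < P.prob x → (P.scaledColumn (P.mixture B) x ⬝ᵥ w) ^ 2 =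
      ∑ b, ∑ b', β x b * β x b' * (u b * u b') := by
    intro x hx
    rw [P.scaledColumn_dotProduct _ (hβ x hx), sq, Finset.sum_mul_sum]
    exact Finset.sum_congr rfl fun b _ => Finset.sum_congr rfl fun b' _ => by ring
  have hemp : ∑ i, (P.scaledColumn (P.mixture B) (X i) ⬝ᵥ w) ^ 2 =
      ∑ b, ∑ b', (∑ i, β (X i) b * β (X i) b') * (u b * u b') := by
    rw [Finset.sum_congr rfl fun i _ => hsq _ (hX i), Finset.sum_comm]
    refine Finset.sum_congr rfl fun b _ => ?_
    rw [Finset.sum_comm]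
    exact Finset.sum_congr rfl fun b' _ => by rw [Finset.sum_mul]
  have hexp : n * ∑ h, P.prob h * (P.scaledColumn (P.mixture B) h ⬝ᵥ w) ^ 2 =
      ∑ b, ∑ b', (n * ∑ h, P.prob h * (β h b * β h b')) * (u b * u b') := by
    have h1 : ∀ h : Fin t → O, P.prob h * (P.scaledColumn (P.mixture B) h ⬝ᵥ w) ^ 2 =
        ∑ b, ∑ b', P.prob h * (β h b * β h b') * (u b * u b') := by
      intro h
      rcases (P.prob_nonneg ht h).eq_or_lt with h0 | hpos
      · simp [← h0]
      · rw [hsq h hpos]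
        simp only [Finset.mul_sum, mul_assoc]
    rw [Finset.sum_congr rfl fun h _ => h1 h, Finset.sum_comm, Finset.mul_sum]
    refine Finset.sum_congr rfl fun b _ => ?_
    rw [Finset.sum_comm, Finset.mul_sum]
    exact Finset.sum_congr rfl fun b' _ => by rw [← Finset.sum_mul, mul_assoc]
  rw [hemp, hexp]
  refine le_trans ?_ (sum_sum_mul_mul_ge hη hdev u)
  -- One factor `m` comes from bounding an entrywise error as a quadratic form, the other from this
  -- estimate of `∑ u²`.
  have h2 := P.sum_scaledColumn_mixture_sq_le ht B w
  rw [Fintype.card_fin]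
  gcongr

end SeqDist

/-! ### Concentration for random samples. -/

namespace IsRandomSample

variable {O : Type*} [Fintype O] [MeasurableSpace O] {T : ℕ}
  {P : SeqDist O T} {Ω : Type*} [MeasurableSpace Ω] {μ : Measure Ω} {t n : ℕ}
  {X : Fin n → Ω → Fin t → O}

theorem measure_prob_not_pos (hX : IsRandomSample P μ X) (i : Fin n) :
    μ {ω | ¬ 0 < P.prob (X i ω)} = 0 := by
  refine measure_mono_null (t := ⋃ h : Fin t → O, {ω | X i ω = h ∧ ¬ 0 < P.prob h})
    (fun ω hω => Set.mem_iUnion.2 ⟨X i ω, rfl, hω⟩) (measure_iUnion_null fun h => ?_)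
  by_cases hh : 0 < P.prob h
  · simp [hh]
  · simp [hh, hX.law i h, ENNReal.ofReal_eq_zero.2 (not_lt.1 hh)]

variable [MeasurableSingletonClass O] [IsProbabilityMeasure μ]

theorem integral_comp (hX : IsRandomSample P μ X) (ht : t ≤ T) (i : Fin n)
    (g : (Fin t → O) → ℝ) : ∫ ω, g (X i ω) ∂μ = ∑ h, P.prob h * g h := by
  have hg : Measurable g := measurable_of_countable g
  have := Measure.isProbabilityMeasure_map (hX.measurable i).aemeasurable (μ := μ)
  rw [← integral_map (hX.measurable i).aemeasurable hg.aestronglyMeasurable,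
    integral_fintype .of_finite]
  refine Finset.sum_congr rfl fun h _ => ?_
  rw [map_measureReal_apply (hX.measurable i) (measurableSet_singleton h), smul_eq_mul]
  congr 1
  have : X i ⁻¹' {h} = {ω | X i ω = h} := rfl
  rw [this, measureReal_def, hX.law i h, ENNReal.toReal_ofReal (P.prob_nonneg ht h)]

theorem measureReal_sum_sub_ge_le (hX : IsRandomSample P μ X) (ht : t ≤ T)
    {g : (Fin t → O) → ℝ} (hg : ∀ h, 0 < P.prob h → |g h| ≤ 1) {ε : ℝ} (hε : 0 ≤ ε) :
    μ.real {ω | n * ε ≤ ∑ i, g (X i ω) - n * ∑ h, P.prob h * g h} ≤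
      Real.exp (-(n * ε ^ 2 / 2)) := by
  have hgm : Measurable g := measurable_of_countable g
  have hsub : ∀ i, HasSubgaussianMGF
      (fun ω => g (X i ω) - ∑ h, P.prob h * g h) 1 μ := by
    intro i
    have h1 : ∀ᵐ ω ∂μ, g (X i ω) ∈ Set.Icc (-1 : ℝ) 1 := by
      have h2 : ∀ᵐ ω ∂μ, 0 < P.prob (X i ω) := hX.measure_prob_not_pos i
      filter_upwards [h2] with ω hω using abs_le.1 (hg _ hω)
    have h3 := hasSubgaussianMGF_of_mem_Icc (hgm.comp (hX.measurable i)).aemeasurable h1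
    -- The sub-Gaussian parameter is the squared half-length of `[-1, 1]`.
    have h4 : (‖(1 : ℝ) - -1‖₊ / 2) ^ 2 = 1 := by
      ext
      norm_num
    rw [h4] at h3
    simpa only [Function.comp_def, hX.integral_comp ht i g] using h3
  have hind := hX.indep.comp (fun _ h => g h - ∑ h, P.prob h * g h)
    fun _ => hgm.sub_const _
  have h := HasSubgaussianMGF.measure_sum_ge_le_of_iIndepFun hind (c := fun _ => 1)
    (s := Finset.univ) (fun i _ => hsub i) (ε := n * ε) (by positivity)
  have hset : {ω | n * ε ≤ ∑ i, ((fun h => g h - ∑ h, P.prob h * g h) ∘ X i) ω} =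
      {ω | n * ε ≤ ∑ i, g (X i ω) - n * ∑ h, P.prob h * g h} := by
    ext ω
    simp [Finset.sum_sub_distrib]
  rw [hset] at h
  refine h.trans (le_of_eq ?_)
  congr 1
  rcases Nat.eq_zero_or_pos n with rfl | hn
  · simp
  · have : (n : ℝ) ≠ 0 := by exact_mod_cast hn.ne'
    simp
    field_simp

/-- **Hoeffding's inequality** for a bounded statistic of a random sample. -/
theorem measureReal_abs_sum_sub_ge_le (hX : IsRandomSample P μ X) (ht : t ≤ T)
    {g : (Fin t → O) → ℝ} (hg : ∀ h, 0 < P.prob h → |g h| ≤ 1) {ε : ℝ} (hε : 0 ≤ ε) :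
    μ.real {ω | n * ε ≤ |∑ i, g (X i ω) - n * ∑ h, P.prob h * g h|} ≤
      2 * Real.exp (-(n * ε ^ 2 / 2)) := by
  have h1 := hX.measureReal_sum_sub_ge_le ht hg hε
  have h2 := hX.measureReal_sum_sub_ge_le ht (g := fun h => -g h) (by simpa using hg) hε
  calc _ ≤ μ.real ({ω | n * ε ≤ ∑ i, g (X i ω) - n * ∑ h, P.prob h * g h} ∪
        {ω | n * ε ≤ ∑ i, -g (X i ω) - n * ∑ h, P.prob h * -g h}) := by
        refine measureReal_mono fun ω hω => ?_
        rw [Set.mem_ofPred_eq] at hω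
        rcases le_abs.1 hω with h | h
        · exact Or.inl h
        · refine Or.inr (h.trans (le_of_eq ?_))
          simp
          ring
    _ ≤ _ := (measureReal_union_le _ _).trans (by linarith)

end IsRandomSample

/-! ### Robustness at a single length. -/

namespace SeqDist

variable {O : Type*} [Fintype O] {T : ℕ}

/-- An empty family would represent `Pr[F_t | x]` by zero, although its entries sum to one; so `1 ≤
m ≤ 1/Δ'`. -/
theorem le_one_of_card_le (P : SeqDist O T) {t m : ℕ} (ht : t ≤ T) {B : Fin m → Fin t → O}
    (hB : ∀ x : Fin t → O, 0 < P.prob x → ∃ β : EuclideanSpace ℝ (Fin m),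
      (∀ f : Fin (T - t) → O,
        P.condProb (List.ofFn x) (List.ofFn f) = (P.condMatrix B *ᵥ β.ofLp) f) ∧ ‖β‖ ≤ 1)
    {Δ' : ℝ} (hΔ : 0 < Δ') (hm : (m : ℝ) ≤ 1 / Δ') : Δ' ≤ 1 := by
  have hm0 : m ≠ 0 := by
    rintro rfl
    obtain ⟨x, hx⟩ := P.exists_prob_pos ht
    obtain ⟨β, hβ, -⟩ := hB x hx
    have := P.sum_condProb (T - t) (List.ofFn x) (by simp; omega)
    simp [hβ, Matrix.mulVec, dotProduct] at this
  have h1 : (1 : ℝ) ≤ m := by exact_mod_cast Nat.one_le_iff_ne_zero.2 hm0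
  have := h1.trans hm
  rwa [le_div_iff₀ hΔ, one_mul] at this

theorem condProb_le_mul_mixture (P : SeqDist O T) {t m : ℕ} (ht : t ≤ T) (B : Fin m → Fin t → O)
    {x : Fin t → O} {β : Fin m → ℝ} (hβ1 : ∀ b, |β b| ≤ 1) {f : Fin (T - t) → O}
    (hβ : P.condProb (List.ofFn x) (List.ofFn f) = (P.condMatrix B *ᵥ β) f) :
    P.condProb (List.ofFn x) (List.ofFn f) ≤ m * P.mixture B f := by
  have h1 : (m : ℝ) * P.mixture B f = ∑ b, P.condMatrix B f b := by
    rcases Nat.eq_zero_or_pos m with rfl | hm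
    · simp
    · have : (m : ℝ) ≠ 0 := by exact_mod_cast hm.ne'
      rw [mixture]
      field_simp
  rw [hβ, h1]
  rw [Matrix.mulVec, dotProduct]
  refine Finset.sum_le_sum fun b _ => ?_
  have h2 := P.condMatrix_nonneg ht B f b
  nlinarith [le_abs_self (β b), hβ1 b]

/-- The row of the empty future consists of ones, so the matrix is nonzero. This yields `log (T/δ) ≤
log (rT/δ)` in the main proof. -/
theorem one_le_of_hasRank (P : SeqDist O T) {r : ℕ} (hT : 1 ≤ T) (hr : P.HasRank r) : 1 ≤ r := by
  refine le_trans ?_ (hr 1 (by simpa using hT))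
  classical
  obtain ⟨h, -⟩ := P.exists_prob_pos hT
  rw [Nat.one_le_iff_ne_zero]
  intro h0
  rw [Matrix.rank, Submodule.finrank_eq_zero, LinearMap.range_eq_bot] at h0
  have h1 := congrFun (LinearMap.congr_fun h0 (Pi.single h 1)) ⟨0, fun i => i.elim0⟩
  simp [fullCondMatrix, condProb] at h1

variable [DecidableEq O]

/-- If there are no future observations, any nonempty family of histories of positive probability
is a well-conditioned basis. -/
theorem robust_of_no_future (P : SeqDist O T) {n : ℕ} (hn : 0 < n)
    {B : Fin n → Fin T → O} (hB : ∀ i, 0 < P.prob (B i)) :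
    (∀ x : Fin T → O, 0 < P.prob x → ∃ β : EuclideanSpace ℝ (Fin n),
      (∀ f : Fin (T - T) → O,
        P.condProb (List.ofFn x) (List.ofFn f) = (P.condMatrix B *ᵥ β.ofLp) f) ∧ ‖β‖ ≤ 1) ∧
    (n : ℝ) ≤ sigmaPlus (P.precondMatrix B) := by
  have hone : ∀ (h : Fin T → O) (f : Fin (T - T) → O),
      P.condProb (List.ofFn h) (List.ofFn f) = 1 := by
    intro h f
    have : List.ofFn f = [] := by simp
    rw [this, condProb]
  -- The only future is the empty string and every scaled column is the scalar `1`, so the Gram form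
  -- is exactly `n w²`.
  have h := P.coeff_and_sigmaPlus_of_gram_ge le_rfl hn hB (q := fun _ => 1)
    (fun _ => zero_le_one) (K := 1) (γ := n) one_pos (by exact_mod_cast hn)
    (fun h _ f => by rw [hone, mul_one]) (W := ⊤) (fun _ _ => trivial) (fun w _ => ?_)
  · simpa using h
  · have hs : Subsingleton (Fin (T - T) → O) := by
      rw [Nat.sub_self]
      infer_instance
    have hi : Nonempty (Fin (T - T) → O) := by
      rw [Nat.sub_self]
      infer_instance
    obtain ⟨f₀⟩ := hi
    have hsum : ∀ g : (Fin (T - T) → O) → ℝ, ∑ f, g f = g f₀ := fun g =>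
      Fintype.sum_subsingleton g f₀
    simp only [dotProduct, hsum, scaledColumn, hone]
    simp [sq]

variable [MeasurableSpace O] [MeasurableSingletonClass O]

/-- For a single length `t`: a random sample fails to be a well-conditioned basis with
exponentially small probability. -/
theorem measure_not_robust_le (P : SeqDist O T) {t m n : ℕ} (ht : t ≤ T) {B : Fin m → Fin t → O}
    (hB : ∀ x : Fin t → O, 0 < P.prob x → ∃ β : EuclideanSpace ℝ (Fin m),
      (∀ f : Fin (T - t) → O,
        P.condProb (List.ofFn x) (List.ofFn f) = (P.condMatrix B *ᵥ β.ofLp) f) ∧ ‖β‖ ≤ 1)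
    {Δ' : ℝ} (hΔ : 0 < Δ') (hm : (m : ℝ) ≤ 1 / Δ') (hfid : Δ' ≤ sigmaPlus (P.fidelityMatrix B))
    (hn : 2 ≤ n * Δ' ^ 2)
    {Ω : Type*} [MeasurableSpace Ω] {μ : Measure Ω} [IsProbabilityMeasure μ]
    {X : Fin n → Ω → Fin t → O} (hX : IsRandomSample P μ X) :
    μ {ω | ¬ ((∀ x : Fin t → O, 0 < P.prob x → ∃ β : EuclideanSpace ℝ (Fin n),
        (∀ f : Fin (T - t) → O, P.condProb (List.ofFn x) (List.ofFn f) =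
          (P.condMatrix (fun i => X i ω) *ᵥ β.ofLp) f) ∧ ‖β‖ ≤ 1) ∧
        n * Δ' ^ 2 / 2 ≤ sigmaPlus (P.precondMatrix fun i => X i ω))} ≤
      ENNReal.ofReal (2 / Δ' ^ 2 * Real.exp (-(n * Δ' ^ 6 / 8))) := by
  have hn0 : 0 < n := by
    rcases Nat.eq_zero_or_pos n with rfl | h
    · norm_num at hn
    · exact h
  have hn' : (0 : ℝ) < n := by exact_mod_cast hn0
  have hch : ∀ x : Fin t → O, ∃ β : Fin m → ℝ, 0 < P.prob x →
      (∀ f : Fin (T - t) → O,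
        P.condProb (List.ofFn x) (List.ofFn f) = (P.condMatrix B *ᵥ β) f) ∧ ∀ b, |β b| ≤ 1 := by
    intro x
    by_cases hx : 0 < P.prob x
    · obtain ⟨β, h1, h2⟩ := hB x hx
      exact ⟨β.ofLp, fun _ => ⟨h1, fun b => (PiLp.norm_apply_le β b).trans h2⟩⟩
    · exact ⟨0, fun h => absurd h hx⟩
  choose β hβ using hch
  -- The threshold is chosen so that `m²` errors of size `n Δ'³ / 2`, with `m ≤ 1/Δ'`, cost at most
  -- `n Δ' / 2`, half of the guaranteed `n Δ'`.
  set dev : Fin m × Fin m → Set Ω := fun c => {ω | n * (Δ' ^ 3 / 2) ≤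
    |∑ i, β (X i ω) c.1 * β (X i ω) c.2 -
      n * ∑ h, P.prob h * (β h c.1 * β h c.2)|} with hdev
  have hdev_le : ∀ c, μ (dev c) ≤ ENNReal.ofReal (2 * Real.exp (-(n * Δ' ^ 6 / 8))) := by
    intro c
    have h := hX.measureReal_abs_sum_sub_ge_le ht (g := fun h => β h c.1 * β h c.2)
      (fun h hh => by
        rw [abs_mul]
        exact mul_le_one₀ ((hβ h hh).2 _) (abs_nonneg _) ((hβ h hh).2 _))
      (ε := Δ' ^ 3 / 2) (by positivity)
    rw [show n * (Δ' ^ 3 / 2) ^ 2 / 2 = n * Δ' ^ 6 / 8 by ring] at h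
    rw [← ofReal_measureReal]
    exact ENNReal.ofReal_le_ofReal h
  have hsub : {ω | ¬ ((∀ x : Fin t → O, 0 < P.prob x → ∃ β : EuclideanSpace ℝ (Fin n),
        (∀ f : Fin (T - t) → O, P.condProb (List.ofFn x) (List.ofFn f) =
          (P.condMatrix (fun i => X i ω) *ᵥ β.ofLp) f) ∧ ‖β‖ ≤ 1) ∧
        n * Δ' ^ 2 / 2 ≤ sigmaPlus (P.precondMatrix fun i => X i ω))} ⊆
      (⋃ i, {ω | ¬ 0 < P.prob (X i ω)}) ∪ ⋃ c, dev c := by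
    intro ω hω
    by_contra hcon
    simp only [Set.mem_union, Set.mem_iUnion, not_or, not_exists, Set.mem_ofPred_eq, not_not,
      hdev, not_le] at hcon
    obtain ⟨hpos, hclose⟩ := hcon
    refine hω ?_
    have hgram : ∀ w ∈ P.weightedRange t (P.mixture B), n * Δ' / 2 * (w ⬝ᵥ w) ≤
        ∑ i, (P.scaledColumn (P.mixture B) (X i ω) ⬝ᵥ w) ^ 2 := by
      intro w hw
      have h1 := P.gram_ge_of_moments_close ht (fun x hx => (hβ x hx).1) hpos
        (η := n * (Δ' ^ 3 / 2)) (by positivity) (fun b b' => (hclose (b, b')).le) w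
      have h2 := P.sigmaPlus_fidelityMatrix_le ht B hw
      have hww : 0 ≤ w ⬝ᵥ w := Finset.sum_nonneg fun f _ => mul_self_nonneg _
      have h3 : Δ' * (w ⬝ᵥ w) ≤
          ∑ h, P.prob h * (P.scaledColumn (P.mixture B) h ⬝ᵥ w) ^ 2 :=
        (mul_le_mul_of_nonneg_right hfid hww).trans h2
      have h4 : n * (Δ' ^ 3 / 2) * (m * (m * (w ⬝ᵥ w))) ≤ n * Δ' / 2 * (w ⬝ᵥ w) := by
        calc n * (Δ' ^ 3 / 2) * (m * (m * (w ⬝ᵥ w)))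
            ≤ n * (Δ' ^ 3 / 2) * (1 / Δ' * (1 / Δ' * (w ⬝ᵥ w))) := by gcongr
          _ = n * Δ' / 2 * (w ⬝ᵥ w) := by field_simp
      have h5 := mul_le_mul_of_nonneg_left h3 hn'.le
      linarith
    -- The condition `K ≤ γ` is exactly `2 ≤ n Δ'²`.
    have h6 := P.coeff_and_sigmaPlus_of_gram_ge ht hn0 hpos (P.mixture_nonneg ht B)
      (K := 1 / Δ') (γ := n * Δ' / 2) (by positivity)
      (by rw [div_le_iff₀ hΔ]; linarith)
      (fun h hh f => (P.condProb_le_mul_mixture ht B (hβ h hh).2 ((hβ h hh).1 f)).trans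
        (mul_le_mul_of_nonneg_right hm (P.mixture_nonneg ht B f)))
      (P.scaledColumn_mem_weightedRange _) hgram
    refine ⟨h6.1, le_trans (le_of_eq ?_) h6.2⟩
    field_simp
  refine (measure_mono hsub).trans ((measure_union_le _ _).trans ?_)
  rw [measure_iUnion_null fun i => hX.measure_prob_not_pos i, zero_add]
  refine (measure_iUnion_fintype_le _ _).trans ((Finset.sum_le_sum fun c _ => hdev_le c).trans ?_)
  rw [Finset.sum_const, ← ENNReal.ofReal_nsmul]
  refine ENNReal.ofReal_le_ofReal ?_
  simp only [Finset.card_univ, Fintype.card_prod, Fintype.card_fin, nsmul_eq_mul, Nat.cast_mul]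
  calc (m : ℝ) * m * (2 * Real.exp (-(n * Δ' ^ 6 / 8)))
      ≤ (1 / Δ') * (1 / Δ') * (2 * Real.exp (-(n * Δ' ^ 6 / 8))) := by gcongr
    _ = _ := by field_simp

end SeqDist

/-! ### Union bound, choice of constants and conclusion. -/

/-- Only subadditivity is used, so the event need not be measurable. -/
theorem ofReal_one_sub_le_of_measure_compl_le {Ω : Type*} [MeasurableSpace Ω] {μ : Measure Ω}
    [IsProbabilityMeasure μ] {s : Set Ω} {δ : ℝ} (hδ : 0 ≤ δ) (h : μ sᶜ ≤ ENNReal.ofReal δ) :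
    ENNReal.ofReal (1 - δ) ≤ μ s := by
  rw [ENNReal.ofReal_sub _ hδ, ENNReal.ofReal_one, tsub_le_iff_right]
  calc (1 : ENNReal) = μ (s ∪ sᶜ) := by rw [Set.union_compl_self, measure_univ]
    _ ≤ μ s + μ sᶜ := measure_union_le _ _
    _ ≤ μ s + ENNReal.ofReal δ := by gcongr

/-- The failure probabilities for the `T` lengths add up to at most `δ`. -/
theorem mul_exp_le_of_sample_size {T L Δ' δ n : ℝ} (hT : 0 < T) (hΔ : 0 < Δ') (hΔ1 : Δ' ≤ 1)
    (hδ : 0 < δ) (hL2 : 1 / 2 ≤ L) (hL : Real.log (T / δ) ≤ L) (hn : 40 * L ≤ n * Δ' ^ 8) :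
    T * (2 / Δ' ^ 2 * Real.exp (-(n * Δ' ^ 6 / 8))) ≤ δ := by
  have hΔ2 : 0 < Δ' ^ 2 := by positivity
  have h1 : 2 / Δ' ^ 2 ≤ Real.exp (2 / Δ' ^ 2) := by
    linarith [Real.add_one_le_exp (2 / Δ' ^ 2)]
  have h2 : T ≤ δ * Real.exp (L / Δ' ^ 2) := by
    have h3 : L ≤ L / Δ' ^ 2 := by
      rw [le_div_iff₀ hΔ2]
      have := pow_le_one₀ hΔ.le hΔ1 (n := 2)
      nlinarith
    have h4 : T / δ ≤ Real.exp (L / Δ' ^ 2) := by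
      rw [← Real.log_le_iff_le_exp (by positivity)]
      exact hL.trans h3
    rwa [div_le_iff₀' hδ] at h4
  -- The sample size makes the right side at least `5 L / Δ'²`, and `2 ≤ 4 L`.
  have h5 : L / Δ' ^ 2 + 2 / Δ' ^ 2 ≤ n * Δ' ^ 6 / 8 := by
    rw [← add_div, div_le_iff₀ hΔ2]
    nlinarith
  calc T * (2 / Δ' ^ 2 * Real.exp (-(n * Δ' ^ 6 / 8)))
      ≤ (δ * Real.exp (L / Δ' ^ 2)) *
        (Real.exp (2 / Δ' ^ 2) * Real.exp (-(L / Δ' ^ 2 + 2 / Δ' ^ 2))) := by gcongr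
    _ = δ := by
      rw [mul_assoc, ← Real.exp_add, ← Real.exp_add]
      ring_nf
      simp

theorem mainTheorem4 :
    ∃ C c : ℝ, 0 < C ∧ 0 < c ∧
      ∀ (O : Type*) [Fintype O] [DecidableEq O] [MeasurableSpace O] [MeasurableSingletonClass O]
        (T r : ℕ) (P : SeqDist O T) (Δ' δ : ℝ),
        P.HasRank r → 0 < Δ' → P.HasFidelity Δ' → 0 < δ → δ < 1 →
        ∀ n : ℕ, C * Δ' ^ (-8 : ℝ) * Real.log (r * T / δ) ≤ n →
        ∀ (Ω : Type*) [MeasurableSpace Ω] (μ : MeasureTheory.Measure Ω)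
          [MeasureTheory.IsProbabilityMeasure μ] (S : ∀ t : ℕ, Fin n → Ω → Fin t → O),
          (∀ t ∈ Finset.Icc 1 T, IsRandomSample P μ (S t)) →
          ENNReal.ofReal (1 - δ) ≤
            μ {ω | P.IsRobustBases (c * Δ' ^ (-(11 / 2) : ℝ) * Real.log (r * T / δ))
              (m := fun _ => n) (fun t i => S t i ω)} := by
  refine ⟨40, 1, by norm_num, one_pos, ?_⟩
  intro O _ _ _ _ T r P Δ' δ hr hΔ hfid hδ hδ1 n hn Ω _ μ _ S hS
  refine ofReal_one_sub_le_of_measure_compl_le hδ.le ?_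
  obtain ⟨m, B, hB, hfid⟩ := hfid
  set L := Real.log (r * T / δ) with hL
  rcases Nat.eq_zero_or_pos T with rfl | hT
  · refine le_of_eq_of_le (measure_mono_null (t := ∅) ?_ measure_empty) zero_le
    intro ω hω
    refine hω ?_
    exact ⟨fun t ht => by simp at ht, fun t ht => by simp at ht⟩
  have hr1 : (1 : ℝ) ≤ r := by exact_mod_cast P.one_le_of_hasRank hT hr
  have hT1 : (1 : ℝ) ≤ T := by exact_mod_cast hT
  have h1T : 1 ∈ Finset.Icc 1 T := Finset.mem_Icc.2 ⟨le_rfl, hT⟩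
  have hΔ1 : Δ' ≤ 1 := P.le_one_of_card_le hT (hB 1 h1T) hΔ (hfid 1 h1T).1
  have hLT : Real.log (T / δ) ≤ L := by
    refine Real.log_le_log (by positivity) ?_
    gcongr
    nlinarith
  have hTδ : 1 < T / δ := by
    rw [lt_div_iff₀ hδ]
    linarith
  have hL0 : 0 < L := (Real.log_pos hTδ).trans_le hLT
  have hpow : Δ' ^ (-8 : ℝ) = (Δ' ^ 8)⁻¹ := by
    rw [Real.rpow_neg hΔ.le]
    norm_cast
  have hn8 : 40 * L ≤ n * Δ' ^ 8 := by
    rw [hpow, mul_right_comm, ← div_eq_mul_inv, div_le_iff₀ (by positivity)] at hn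
    exact hn
  -- The exponent `11/2` is relaxed to `6`, and `n Δ'⁸ ≥ 40 L` leaves ample room. The case `k = 2`
  -- serves `T ≥ 2`, and `k = 0` serves `T = 1`.
  have hrobust_le : ∀ k : ℕ, k ≤ 2 → 1 * Δ' ^ (-(11 / 2) : ℝ) * L ≤ n * Δ' ^ k / 2 := by
    intro k hk
    have h1 : Δ' ^ (-(11 / 2) : ℝ) ≤ (Δ' ^ 6)⁻¹ := by
      calc Δ' ^ (-(11 / 2) : ℝ) ≤ Δ' ^ (-6 : ℝ) :=
            Real.rpow_le_rpow_of_exponent_ge hΔ hΔ1 (by norm_num)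
        _ = (Δ' ^ 6)⁻¹ := by
            rw [Real.rpow_neg hΔ.le]
            norm_cast
    have h2 : Δ' ^ 2 ≤ Δ' ^ k := pow_le_pow_of_le_one hΔ.le hΔ1 hk
    calc 1 * Δ' ^ (-(11 / 2) : ℝ) * L ≤ 1 * (Δ' ^ 6)⁻¹ * L := by gcongr
      _ = L / Δ' ^ 6 := by rw [one_mul, mul_comm, div_eq_mul_inv]
      _ ≤ n * Δ' ^ 2 / 2 := by
          rw [div_le_iff₀ (by positivity)]
          nlinarith
      _ ≤ n * Δ' ^ k / 2 := by gcongr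
  rcases Nat.lt_or_ge 1 T with hT2 | hT2
  -- For `T ≥ 2` the logarithm is at least `log 2`, which absorbs the factor `2 / Δ'²` of the union
  -- bound.
  · have hL2 : 1 / 2 ≤ L := by
      have h2 : Real.log 2 ≤ Real.log (T / δ) := by
        refine Real.log_le_log two_pos ?_
        rw [le_div_iff₀ hδ]
        have : (2 : ℝ) ≤ T := by exact_mod_cast hT2
        linarith
      linarith [Real.log_two_gt_d9]
    have hn2 : 2 ≤ n * Δ' ^ 2 := by
      have h1 : Δ' ^ 8 ≤ Δ' ^ 2 := pow_le_pow_of_le_one hΔ.le hΔ1 (by norm_num)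
      have h2 : (n : ℝ) * Δ' ^ 8 ≤ n * Δ' ^ 2 := by gcongr
      linarith
    have hbad := fun t (ht : t ∈ Finset.Icc 1 T) =>
      P.measure_not_robust_le (Finset.mem_Icc.1 ht).2 (hB t ht) hΔ (hfid t ht).1 (hfid t ht).2
        hn2 (hS t ht)
    refine le_trans (measure_mono ?_) ((measure_biUnion_finset_le (Finset.Icc 1 T) _).trans
      ((Finset.sum_le_sum hbad).trans ?_))
    · intro ω hω
      by_contra hcon
      simp only [Set.mem_iUnion, not_exists, Set.mem_ofPred_eq, not_not] at hcon
      exact hω ⟨fun t ht => (hcon t ht).1, fun t ht =>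
        (hrobust_le 2 le_rfl).trans (hcon t ht).2⟩
    · rw [Finset.sum_const, Nat.card_Icc, Nat.add_sub_cancel, ← ENNReal.ofReal_nsmul]
      refine ENNReal.ofReal_le_ofReal ?_
      rw [nsmul_eq_mul]
      exact mul_exp_le_of_sample_size (by linarith) hΔ hΔ1 hδ hL2 hLT hn8
  -- With `T = r = 1` and `δ` near `1`, `L` can be arbitrarily small and the tail estimate fails.
  -- But then no future remains, and every sample of positive-probability histories works, which is
  -- almost sure.
  · obtain rfl : T = 1 := le_antisymm hT2 hT
    have hn0 : 0 < n := by
      rcases Nat.eq_zero_or_pos n with rfl | h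
      · simp at hn8
        linarith
      · exact h
    refine (measure_mono_null (t := ⋃ i, {ω | ¬ 0 < P.prob (S 1 i ω)}) (fun ω hω => ?_)
      (measure_iUnion_null fun i => (hS 1 h1T).measure_prob_not_pos i)).trans_le zero_le
    by_contra hcon
    simp only [Set.mem_iUnion, not_exists, Set.mem_ofPred_eq, not_not] at hcon
    have h := P.robust_of_no_future hn0 hcon
    refine hω ⟨fun t ht => ?_, fun t ht => ?_⟩ <;>
      obtain rfl : t = 1 := by simpa using ht
    · exact h.1
    · refine (hrobust_le 0 (by norm_num)).trans (le_trans ?_ h.2)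
      have : (0 : ℝ) ≤ n := n.cast_nonneg
      linarith
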